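/- Let $\mathfrak H$ be a complex Hilbert space with inner product $(\cdot,\cdot)$, and let $a$, $b$ be positive symmetric operators in $\mathfrak H$ (linear operators on not necessarily dense subspaces, with $(ax,y)=(x,ay)$ and $(ax,x)\ge 0$ for $x,y\in\mathrm{dom}\,a$, and likewise for $b$). Let $$D_*(a)=\{y\in\mathfrak H:\ \exists m_y\ \ |(ax,y)|^2\le m_y\,(ax,x)\ \text{ for all } x\in\mathrm{dom}\,a\}$$ be the form domain of $a$, and suppose that $D_*(a)\cap D_*(b)$ is dense in $\mathfrak H$. Let $\mathfrak H_a$ be the completion of $\mathrm{ran}\,a$ with respect to the inner product $\langle ax,ay\rangle=(ax,y)$, define $\mathfrak H_b$ in the same way, and let $J:\mathfrak H_a\oplus\mathfrak H_b\to\mathfrak H$ be the densely defined operator with $$\mathrm{dom}\,J=\mathrm{ran}\,a\oplus\mathrm{ran}\,b,\qquad J(ax\oplus by)=ax+by .$$ For positive selfadjoint operators $A,B$ in $\mathfrak H$ write $A\le B$ if $\mathrm{dom}\,B^{1/2}\subseteq\mathrm{dom}\,A^{1/2}$ and $\|A^{1/2}x\|\le\|B^{1/2}x\|$ for all $x\in\mathrm{dom}\,B^{1/2}$.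 If $\mathrm{dom}\,A^{1/2}\cap\mathrm{dom}\,B^{1/2}$ is dense, the form sum $A\stackrel{.}{+}B$ is the operator associated with the closed form $(A^{1/2}x,A^{1/2}y)+(B^{1/2}x,B^{1/2}y)$ on $D=\mathrm{dom}\,A^{1/2}\cap\mathrm{dom}\,B^{1/2}$; that is, $x\in\mathrm{dom}(A\stackrel{.}{+}B)$ and $(A\stackrel{.}{+}B)x=z$ if and only if $x\in D$ and $(A^{1/2}x,A^{1/2}y)+(B^{1/2}x,B^{1/2}y)=(z,y)$ for all $y\in D$. Then $a$ and $b$ each have a unique smallest positive selfadjoint extension (the Krein–von Neumann extension) $a_{\mathsf K}$, respectively $b_{\mathsf K}$, and $$a_{\mathsf K}\stackrel{.}{+}b_{\mathsf K}=J^{**}J^{*}.$$ -/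

import Mathlib

namespace FormSum

noncomputable section

variable {H : Type*} [NormedAddCommGroup H] [InnerProductSpace ℂ H]

/-- `a` is a positive, symmetric operator: `(ax, y) = (x, ay)` and `(ax, x) ≥ 0` on `dom a`.
The domain is not assumed to be dense. -/
structure IsPositiveSymmetric (a : H →ₗ.[ℂ] H) : Prop where
  symm : ∀ x y : a.domain, inner ℂ (a x) (y : H) = inner ℂ (x : H) (a y)
  nonneg : ∀ x : a.domain, 0 ≤ (inner ℂ (a x) (x : H)).re

/-- The form domain of `a`: all `y` for which there is a constant `m` such that
`|(ax, y)|² ≤ m (ax, x)` for all `x ∈ dom a`. -/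
def formDomain (a : H →ₗ.[ℂ] H) : Set H :=
  {y | ∃ m : ℝ, ∀ x : a.domain, ‖inner ℂ (a x) y‖ ^ 2 ≤ m * (inner ℂ (a x) (x : H)).re}

section EnergySpace

variable {a b : H →ₗ.[ℂ] H}

/-- The range of `a`, as a type of its own which is going to carry the inner product
`⟨ax, ay⟩ = (ax, y)` instead of the one inherited from `H`. -/
def RanSpace (_ha : IsPositiveSymmetric a) (_hd : Dense (formDomain a)) : Type _ :=
  LinearMap.range a.toFun

variable (ha : IsPositiveSymmetric a) (hd : Dense (formDomain a))

instance : AddCommGroup (RanSpace ha hd) :=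
  inferInstanceAs (AddCommGroup (LinearMap.range a.toFun))

instance : Module ℂ (RanSpace ha hd) :=
  inferInstanceAs (Module ℂ (LinearMap.range a.toFun))

/-- The inclusion of `ran a` in `H`. -/
def RanSpace.incl : RanSpace ha hd →ₗ[ℂ] H := (LinearMap.range a.toFun).subtype

/-- A vector `x ∈ dom a` with `ax = u`. -/
def RanSpace.preimage (u : RanSpace ha hd) : a.domain := (LinearMap.mem_range.1 u.2).choose

theorem RanSpace.apply_preimage (u : RanSpace ha hd) :
    a (RanSpace.preimage ha hd u) = RanSpace.incl ha hd u :=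
  (LinearMap.mem_range.1 u.2).choose_spec

/-- The inner product `⟨ax, ay⟩ = (ax, y)` on `ran a`; it does not depend on the choice of `y`
(see `RanSpace.inner_eq`), and it is definite because the form domain is dense. -/
@[reducible]
def RanSpace.core : InnerProductSpace.Core ℂ (RanSpace ha hd) where
  inner u v := inner ℂ (RanSpace.incl ha hd u) (RanSpace.preimage ha hd v : H)
  conj_inner_symm u v := by
    rw [inner_conj_symm, ← RanSpace.apply_preimage ha hd u, ← RanSpace.apply_preimage ha hd v,
      ha.symm]
  re_inner_nonneg u := by
    rw [← RanSpace.apply_preimage ha hd u]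
    exact ha.nonneg _
  add_left u v w := by rw [map_add, inner_add_left]
  smul_left u v r := by rw [map_smul, inner_smul_left]
  definite u hu := by
    have hu' : RanSpace.incl ha hd u = 0 := by
      refine hd.eq_zero_of_inner_left (𝕜 := ℂ) fun y hy => ?_
      obtain ⟨m, hm⟩ := hy
      have h := hm (RanSpace.preimage ha hd u)
      rw [RanSpace.apply_preimage, hu] at h
      simpa using h
    exact Subtype.ext hu'

instance : NormedAddCommGroup (RanSpace ha hd) := (RanSpace.core ha hd).toNormedAddCommGroup

instance : InnerProductSpace ℂ (RanSpace ha hd) :=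
  InnerProductSpace.ofCore (RanSpace.core ha hd).toCore

/-- The element `ax` of `ran a`. -/
def RanSpace.mk (x : a.domain) : RanSpace ha hd := ⟨a x, LinearMap.mem_range_self a.toFun x⟩

theorem RanSpace.inner_eq (x y : a.domain) :
    inner ℂ (RanSpace.mk ha hd x) (RanSpace.mk ha hd y) = inner ℂ (a x) (y : H) := by
  have h : a (RanSpace.preimage ha hd (RanSpace.mk ha hd y)) = a y :=
    RanSpace.apply_preimage ha hd _
  change inner ℂ (a x) (RanSpace.preimage ha hd (RanSpace.mk ha hd y) : H) = _
  rw [ha.symm, h, ha.symm]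

/-- The Hilbert space `H_a`: the completion of `ran a` for the inner product `⟨ax, ay⟩ = (ax, y)`. -/
abbrev EnergySpace : Type _ := UniformSpace.Completion (RanSpace ha hd)

variable (hb : IsPositiveSymmetric b) (hdb : Dense (formDomain b))

/-- The embedding of `ran a ⊕ ran b` in the Hilbert space direct sum `H_a ⊕ H_b`. -/
def ranSumEmbedding : RanSpace ha hd × RanSpace hb hdb →ₗ[ℂ]
    WithLp 2 (EnergySpace ha hd × EnergySpace hb hdb) :=
  (WithLp.linearEquiv 2 ℂ (EnergySpace ha hd × EnergySpace hb hdb)).symm.toLinearMap ∘ₗ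
    LinearMap.prodMap
      (UniformSpace.Completion.toComplₗᵢ (𝕜 := ℂ) (E := RanSpace ha hd)).toLinearMap
      (UniformSpace.Completion.toComplₗᵢ (𝕜 := ℂ) (E := RanSpace hb hdb)).toLinearMap

theorem ranSumEmbedding_injective : Function.Injective (ranSumEmbedding ha hd hb hdb) := by
  refine (WithLp.linearEquiv 2 ℂ
    (EnergySpace ha hd × EnergySpace hb hdb)).symm.injective.comp ?_
  exact Function.Injective.prodMap
    (UniformSpace.Completion.toComplₗᵢ (𝕜 := ℂ) (E := RanSpace ha hd)).injective
    (UniformSpace.Completion.toComplₗᵢ (𝕜 := ℂ) (E := RanSpace hb hdb)).injective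

/-- The operator `J : H_a ⊕ H_b → H` with `dom J = ran a ⊕ ran b` and `J (ax ⊕ by) = ax + by`. -/
def sumOperator (hab : Dense (formDomain a ∩ formDomain b)) :
    WithLp 2 (EnergySpace ha (hab.mono Set.inter_subset_left) ×
      EnergySpace hb (hab.mono Set.inter_subset_right)) →ₗ.[ℂ] H where
  domain := LinearMap.range (ranSumEmbedding ha (hab.mono Set.inter_subset_left) hb
    (hab.mono Set.inter_subset_right))
  toFun := LinearMap.coprod (RanSpace.incl ha _) (RanSpace.incl hb _) ∘ₗ
    (LinearEquiv.ofInjective _ (ranSumEmbedding_injective ha (hab.mono Set.inter_subset_left) hb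
      (hab.mono Set.inter_subset_right))).symm.toLinearMap

theorem sumOperator_apply (hab : Dense (formDomain a ∩ formDomain b)) (x : a.domain)
    (y : b.domain) :
    sumOperator ha hb hab ⟨ranSumEmbedding ha _ hb _ (RanSpace.mk ha _ x, RanSpace.mk hb _ y),
      LinearMap.mem_range_self _ _⟩ = a x + b y := by
  change LinearMap.coprod (RanSpace.incl ha _) (RanSpace.incl hb _)
    ((LinearEquiv.ofInjective _ (ranSumEmbedding_injective ha _ hb _)).symm
      (LinearEquiv.ofInjective _ (ranSumEmbedding_injective ha _ hb _)
        (RanSpace.mk ha _ x, RanSpace.mk hb _ y))) = _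
  rw [LinearEquiv.symm_apply_apply]
  rfl

end EnergySpace

/-- The product `g f` of two unbounded operators, defined on all `x ∈ dom f` with `f x ∈ dom g`. -/
def product {E F G : Type*} [AddCommGroup E] [Module ℂ E] [AddCommGroup F] [Module ℂ F]
    [AddCommGroup G] [Module ℂ G] (g : F →ₗ.[ℂ] G) (f : E →ₗ.[ℂ] F) : E →ₗ.[ℂ] G :=
  g.comp (f.domRestrict ((g.domain.comap f.toFun).map f.domain.subtype)) (by
    rintro ⟨x, hx⟩
    obtain ⟨hx₁, hx₂⟩ := Submodule.mem_inf.1 hx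
    obtain ⟨y, hy, rfl⟩ := Submodule.mem_map.1 hx₁
    exact hy)

theorem mem_product_domain {E F G : Type*} [AddCommGroup E] [Module ℂ E] [AddCommGroup F]
    [Module ℂ F] [AddCommGroup G] [Module ℂ G] (g : F →ₗ.[ℂ] G) (f : E →ₗ.[ℂ] F) (x : E) :
    x ∈ (product g f).domain ↔ ∃ hx : x ∈ f.domain, f ⟨x, hx⟩ ∈ g.domain := by
  constructor
  · intro hx
    obtain ⟨hx₁, hx₂⟩ := Submodule.mem_inf.1 hx
    obtain ⟨y, hy, rfl⟩ := Submodule.mem_map.1 hx₁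
    exact ⟨y.2, hy⟩
  · rintro ⟨hx, h⟩
    exact Submodule.mem_inf.2 ⟨Submodule.mem_map.2 ⟨⟨x, hx⟩, h, rfl⟩, hx⟩

theorem product_apply {E F G : Type*} [AddCommGroup E] [Module ℂ E] [AddCommGroup F]
    [Module ℂ F] [AddCommGroup G] [Module ℂ G] (g : F →ₗ.[ℂ] G) (f : E →ₗ.[ℂ] F) (x : E)
    (hx : x ∈ f.domain) (h : f ⟨x, hx⟩ ∈ g.domain) :
    product g f ⟨x, (mem_product_domain g f x).2 ⟨hx, h⟩⟩ = g ⟨f ⟨x, hx⟩, h⟩ := rfl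

variable [CompleteSpace H]

/-- Positive selfadjoint operators; selfadjointness includes that the domain is dense. -/
structure IsPositiveSelfAdjoint (A : H →ₗ.[ℂ] H) : Prop where
  selfAdjoint : IsSelfAdjoint A
  nonneg : ∀ x : A.domain, 0 ≤ (inner ℂ (A x) (x : H)).re

/-- `R` is a positive selfadjoint square root of `A`. -/
def IsSqrt (R A : H →ₗ.[ℂ] H) : Prop := IsPositiveSelfAdjoint R ∧ product R R = A

open scoped Classical in
/-- The positive selfadjoint square root of a positive selfadjoint operator (which exists and is
unique; for other operators the value is irrelevant). -/
def sqrt (A : H →ₗ.[ℂ] H) : H →ₗ.[ℂ] H := if h : ∃ R, IsSqrt R A then h.choose else ⊥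

/-- The order of positive selfadjoint operators: `A ≤ B` if `dom B^(1/2) ⊆ dom A^(1/2)` and
`‖A^(1/2) x‖ ≤ ‖B^(1/2) x‖` for all `x ∈ dom B^(1/2)`. -/
def FormLE (A B : H →ₗ.[ℂ] H) : Prop :=
  ∀ (x : H) (hB : x ∈ (sqrt B).domain),
    ∃ hA : x ∈ (sqrt A).domain, ‖sqrt A ⟨x, hA⟩‖ ≤ ‖sqrt B ⟨x, hB⟩‖

/-- `T` is the Krein-von Neumann extension of `a`: the smallest positive selfadjoint extension. -/
structure IsKreinVonNeumannExtension (a T : H →ₗ.[ℂ] H) : Prop where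
  positiveSelfAdjoint : IsPositiveSelfAdjoint T
  extends_op : a ≤ T
  least : ∀ S : H →ₗ.[ℂ] H, IsPositiveSelfAdjoint S → a ≤ S → FormLE T S

/-- The graph of the operator associated with the form `q_A + q_B`, where
`q_A (x, y) = (A^(1/2) x, A^(1/2) y)`: all pairs `(x, z)` such that `x` lies in
`D = dom A^(1/2) ∩ dom B^(1/2)` and `q_A (y, x) + q_B (y, x) = (y, z)` for all `y ∈ D`. -/
def formSumGraph (A B : H →ₗ.[ℂ] H) : Submodule ℂ (H × H) where
  carrier := {p | ∃ (hA : p.1 ∈ (sqrt A).domain) (hB : p.1 ∈ (sqrt B).domain),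
    ∀ (y : H) (kA : y ∈ (sqrt A).domain) (kB : y ∈ (sqrt B).domain),
      inner ℂ (sqrt A ⟨y, kA⟩) (sqrt A ⟨p.1, hA⟩) + inner ℂ (sqrt B ⟨y, kB⟩) (sqrt B ⟨p.1, hB⟩) =
        inner ℂ y p.2}
  zero_mem' := by
    refine ⟨Submodule.zero_mem _, Submodule.zero_mem _, fun y kA kB => ?_⟩
    have h₁ : sqrt A ⟨(0 : H × H).1, Submodule.zero_mem _⟩ = 0 := (sqrt A).map_zero
    have h₂ : sqrt B ⟨(0 : H × H).1, Submodule.zero_mem _⟩ = 0 := (sqrt B).map_zero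
    rw [h₁, h₂]
    simp
  add_mem' := by
    rintro p q ⟨hA, hB, h⟩ ⟨hA', hB', h'⟩
    refine ⟨Submodule.add_mem _ hA hA', Submodule.add_mem _ hB hB', fun y kA kB => ?_⟩
    have h₁ : sqrt A ⟨(p + q).1, Submodule.add_mem _ hA hA'⟩ = sqrt A ⟨p.1, hA⟩ + sqrt A ⟨q.1, hA'⟩ :=
      (sqrt A).map_add ⟨p.1, hA⟩ ⟨q.1, hA'⟩
    have h₂ : sqrt B ⟨(p + q).1, Submodule.add_mem _ hB hB'⟩ = sqrt B ⟨p.1, hB⟩ + sqrt B ⟨q.1, hB'⟩ :=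
      (sqrt B).map_add ⟨p.1, hB⟩ ⟨q.1, hB'⟩
    rw [h₁, h₂, inner_add_right, inner_add_right, Prod.snd_add, inner_add_right, ← h y kA kB,
      ← h' y kA kB]
    ring
  smul_mem' := by
    rintro c p ⟨hA, hB, h⟩
    refine ⟨Submodule.smul_mem _ c hA, Submodule.smul_mem _ c hB, fun y kA kB => ?_⟩
    have h₁ : sqrt A ⟨(c • p).1, Submodule.smul_mem _ c hA⟩ = c • sqrt A ⟨p.1, hA⟩ :=
      (sqrt A).map_smul c ⟨p.1, hA⟩
    have h₂ : sqrt B ⟨(c • p).1, Submodule.smul_mem _ c hB⟩ = c • sqrt B ⟨p.1, hB⟩ :=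
      (sqrt B).map_smul c ⟨p.1, hB⟩
    rw [h₁, h₂, inner_smul_right, inner_smul_right, Prod.smul_snd, inner_smul_right, ← h y kA kB]
    ring

theorem formSumGraph_singleValued (A B : H →ₗ.[ℂ] H)
    (hD : Dense (((sqrt A).domain ⊓ (sqrt B).domain : Submodule ℂ H) : Set H)) :
    ∀ p ∈ formSumGraph A B, p.1 = 0 → p.2 = 0 := by
  rintro ⟨x, z⟩ ⟨hA, hB, h⟩ hx
  have hx' : x = 0 := hx
  subst hx'
  refine hD.eq_zero_of_inner_right (𝕜 := ℂ) fun y hy => ?_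
  have h₁ : sqrt A ⟨0, hA⟩ = 0 := (sqrt A).map_zero
  have h₂ : sqrt B ⟨0, hB⟩ = 0 := (sqrt B).map_zero
  have := h y hy.1 hy.2
  simpa [h₁, h₂] using this.symm

/-- The form sum of positive selfadjoint operators `A`, `B` for which
`dom A^(1/2) ∩ dom B^(1/2)` is dense: the operator that the representation theorem associates with
the closed form `q_A + q_B`. Its graph is single-valued by `formSumGraph_singleValued`. -/
def formSum (A B : H →ₗ.[ℂ] H) : H →ₗ.[ℂ] H := (formSumGraph A B).toLinearPMap

end

end FormSum

/-! Let `J_a` be the map `ax ↦ ax` from `H_a` to `H`. Its adjoint `T = J_a*` is closed, and its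
domain is exactly the form domain of `a`, hence dense. By von Neumann's theorem `T* T = J_a** J_a*`
is positive and selfadjoint, with form `‖J_a* x‖²`. It extends `a` because `J_a* x = ax` for `x ∈
dom a`. It is the least extension: if `S` is another one, then `‖S^(1/2) z‖² = (az, z)` is the
squared energy norm of `az`. Cauchy–Schwarz for the form of `S` therefore bounds the functional `az
↦ (az, x)` on `H_a` by `‖S^(1/2) x‖`, and the norm of that functional is `‖J_a* x‖`. Since `J* x =
J_a* x ⊕ J_b* x`, the form `‖J* x‖²` is the sum of the two Krein forms on the intersection of their
domains, and `J** J*` is the operator of this sum. The order and the form sum are defined through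
square roots, so two general facts are needed: `exists_isSqrt` (square roots exist) and
`sameForm_sqrt_adjoint_product` (the square root of `T* T` has the form of `T`). The theorem itself
is carried by `isKreinVonNeumannExtension_ranOperator` and `formSum_eq_sumOperator`. -/

namespace FormSum

open LinearPMap hiding map_add map_zero
open Filter Topology

/-! ### Graphs, adjoints and a criterion for selfadjointness. -/

section Graph

variable {H K L : Type*} [NormedAddCommGroup H] [InnerProductSpace ℂ H]
  [NormedAddCommGroup K] [InnerProductSpace ℂ K] [NormedAddCommGroup L] [InnerProductSpace ℂ L]

theorem mem_graph_product_iff (g : K →ₗ.[ℂ] L) (f : H →ₗ.[ℂ] K) (x : H) (z : L) :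
    (x, z) ∈ (product g f).graph ↔ ∃ y, (x, y) ∈ f.graph ∧ (y, z) ∈ g.graph := by
  simp only [mem_graph_iff]
  constructor
  · rintro ⟨⟨x', hx'⟩, rfl, rfl⟩
    obtain ⟨hx, h⟩ := (mem_product_domain g f x').1 hx'
    exact ⟨_, ⟨⟨x', hx⟩, rfl, rfl⟩, ⟨⟨_, h⟩, rfl, rfl⟩⟩
  · rintro ⟨y, ⟨⟨x', hx⟩, rfl, rfl⟩, ⟨⟨y', hy⟩, hy', rfl⟩⟩
    obtain rfl : y' = f ⟨x', hx⟩ := hy'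
    exact ⟨⟨x', (mem_product_domain g f x').2 ⟨hx, hy⟩⟩, rfl, rfl⟩

/-- The graph of `T` as a subspace of the Hilbert space direct sum. -/
noncomputable def hilbertGraph (T : H →ₗ.[ℂ] K) : Submodule ℂ (WithLp 2 (H × K)) :=
  T.graph.comap (WithLp.linearEquiv 2 ℂ (H × K)).toLinearMap

theorem mem_hilbertGraph {T : H →ₗ.[ℂ] K} {p : WithLp 2 (H × K)} :
    p ∈ hilbertGraph T ↔ (p.fst, p.snd) ∈ T.graph := Iff.rfl

theorem isClosed_hilbertGraph {T : H →ₗ.[ℂ] K} (hc : T.IsClosed) :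
    IsClosed (hilbertGraph T : Set (WithLp 2 (H × K))) :=
  hc.preimage (WithLp.prod_continuous_ofLp 2 H K)

theorem dense_of_forall_inner_eq_zero [CompleteSpace H] {S : Submodule ℂ H}
    (h : ∀ y, (∀ x ∈ S, inner ℂ x y = 0) → y = 0) : Dense (S : Set H) := by
  rw [Submodule.dense_iff_topologicalClosure_eq_top, Submodule.topologicalClosure_eq_top_iff,
    Submodule.eq_bot_iff]
  exact fun y hy => h y fun x hx => (Submodule.mem_orthogonal S y).1 hy x hx

theorem re_inner_nonneg_of_mem_graph {A : H →ₗ.[ℂ] H}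
    (hA : ∀ x : A.domain, 0 ≤ (inner ℂ (A x) (x : H)).re) {x z : H} (h : (x, z) ∈ A.graph) :
    0 ≤ (inner ℂ z x).re := by
  obtain ⟨x, rfl, rfl⟩ := (mem_graph_iff A).1 h
  exact hA x

/-- Coercivity of `1 + A` when `z = A x`: it gives injectivity, closed range and the bound `‖(1 +
A)⁻¹‖ ≤ 1`. -/
theorem norm_sq_add_norm_sq_le {x z : H} (h : 0 ≤ (inner ℂ z x).re) :
    ‖x‖ ^ 2 + ‖z‖ ^ 2 ≤ ‖x + z‖ ^ 2 := by
  have h₁ := norm_add_sq (𝕜 := ℂ) z x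
  rw [add_comm z x] at h₁
  simp only [RCLike.re_to_complex] at h₁
  linarith

variable [CompleteSpace H]

theorem mem_graph_adjoint_iff {T : H →ₗ.[ℂ] K} (hT : Dense (T.domain : Set H)) (y : K) (z : H) :
    (y, z) ∈ T.adjoint.graph ↔ ∀ x : T.domain, inner ℂ (T x) y = inner ℂ (x : H) z := by
  rw [adjoint_graph_eq_graph_adjoint hT, Submodule.mem_adjoint_iff]
  constructor
  · intro h x
    exact sub_eq_zero.1 (h x (T x) (T.mem_graph x))
  · intro h x w hxw
    obtain ⟨u, rfl, rfl⟩ := (mem_graph_iff T).1 hxw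
    exact sub_eq_zero.2 (h u)

/-- The operator associated with the form `(T x, T y)` is `T* T`. -/
theorem mem_graph_adjoint_product_iff {T : H →ₗ.[ℂ] K} (hT : Dense (T.domain : Set H)) (x z : H) :
    (x, z) ∈ (product T.adjoint T).graph ↔ ∃ hx : x ∈ T.domain,
      ∀ y : T.domain, inner ℂ (T y) (T ⟨x, hx⟩) = inner ℂ (y : H) z := by
  rw [mem_graph_product_iff]
  constructor
  · rintro ⟨w, hw, h⟩
    obtain ⟨⟨x', hx⟩, rfl, rfl⟩ := (mem_graph_iff T).1 hw
    exact ⟨hx, (mem_graph_adjoint_iff hT _ _).1 h⟩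
  · rintro ⟨hx, h⟩
    exact ⟨_, T.mem_graph ⟨x, hx⟩, (mem_graph_adjoint_iff hT _ _).2 h⟩

theorem IsPositiveSelfAdjoint.symm {A : H →ₗ.[ℂ] H} (hA : IsPositiveSelfAdjoint A)
    (x y : A.domain) : inner ℂ (A x) (y : H) = inner ℂ (x : H) (A y) := by
  have h := (mem_graph_adjoint_iff hA.selfAdjoint.dense_domain y (A y)).1
  rw [isSelfAdjoint_def.1 hA.selfAdjoint] at h
  exact h (A.mem_graph y) x

/-- A positive symmetric operator `A` for which `1 + A` is surjective is selfadjoint. -/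
theorem isPositiveSelfAdjoint_of_surjective {A : H →ₗ.[ℂ] H} (hA : IsPositiveSymmetric A)
    (hsurj : ∀ h, ∃ x z, (x, z) ∈ A.graph ∧ x + z = h) : IsPositiveSelfAdjoint A := by
  have hd : Dense (A.domain : Set H) := by
    refine dense_of_forall_inner_eq_zero fun y hy => ?_
    -- Write `y ⟂ dom A` as `x + A x`; pairing with `x` gives `‖x‖² + (A x, x) = 0`, so `x = 0` and
    -- `y = 0`.
    obtain ⟨x, z, hxz, rfl⟩ := hsurj y
    have h₀ := re_inner_nonneg_of_mem_graph hA.nonneg hxz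
    have h₁ := congrArg Complex.re (hy x (mem_domain_of_mem_graph hxz))
    rw [inner_add_right, inner_self_eq_norm_sq_to_K] at h₁
    have h₂ : ‖x‖ ^ 2 + (inner ℂ z x).re = 0 := by
      rw [← Complex.conj_re, inner_conj_symm]
      simpa [← Complex.ofReal_pow] using h₁
    have hx : x = 0 := norm_eq_zero.1 (by nlinarith [sq_nonneg ‖x‖, norm_nonneg x])
    subst hx
    simpa using graph_fst_eq_zero_snd A hxz rfl
  refine ⟨isSelfAdjoint_def.2 (le_antisymm (le_of_le_graph ?_) ?_), hA.nonneg⟩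
  · rintro ⟨y, w⟩ hyw
    -- With `A* y = w` and `x + A x = y + w`, the vector `y - x` is orthogonal to the range of `1 +
    -- A`, which is everything.
    obtain ⟨x, z, hxz, hsum⟩ := hsurj (y + w)
    have hyw' := (mem_graph_adjoint_iff hd _ _).1 hyw
    obtain ⟨x, rfl, rfl⟩ := (mem_graph_iff A).1 hxz
    have hz : y - x = 0 := by
      obtain ⟨u, v, huv, h⟩ := hsurj (y - x)
      obtain ⟨u, rfl, rfl⟩ := (mem_graph_iff A).1 huv
      rw [← inner_self_eq_zero (𝕜 := ℂ)]
      nth_rewrite 1 [← h]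
      rw [inner_add_left, inner_sub_right (A u), hyw' u, hA.symm u x, ← inner_sub_right,
        ← inner_add_right]
      rw [show y - (x : H) + (w - A x) = 0 by rw [sub_add_sub_comm, hsum, sub_self], inner_zero_right]
    have hy : y = x := sub_eq_zero.1 hz
    have hw : w = A x := by rw [hy] at hsum; exact (add_left_cancel hsum).symm
    rw [hy, hw]
    exact A.mem_graph x
  · exact IsFormalAdjoint.le_adjoint hd fun x y => hA.symm x y

end Graph

/-! ### Von Neumann's theorem on `T* T`, and the form it determines. -/

section AdjointProduct

variable {H K L : Type*} [NormedAddCommGroup H] [InnerProductSpace ℂ H] [CompleteSpace H]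
  [NormedAddCommGroup K] [InnerProductSpace ℂ K] [CompleteSpace K]
  [NormedAddCommGroup L] [InnerProductSpace ℂ L] [CompleteSpace L]

/-- Split `(h, 0)` along the closed graph of `T` and its orthogonal complement. The complement
consists of the pairs `(T* y, -y)`, so the components are `(x, T x)` and `(T* T x, -T x)`. -/
theorem exists_mem_graph_adjoint_product {T : H →ₗ.[ℂ] K} (hT : Dense (T.domain : Set H))
    (hc : T.IsClosed) (h : H) :
    ∃ x z, (x, z) ∈ (product T.adjoint T).graph ∧ x + z = h := by
  have : CompleteSpace (hilbertGraph T) := (isClosed_hilbertGraph hc).completeSpace_coe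
  obtain ⟨p, hp, q, hq, hpq⟩ :=
    (hilbertGraph T).exists_add_mem_mem_orthogonal (WithLp.toLp 2 (h, 0))
  have h₁ : h = p.fst + q.fst := congrArg WithLp.fst hpq
  have h₂ : 0 = p.snd + q.snd := congrArg WithLp.snd hpq
  refine ⟨p.fst, q.fst, ?_, h₁.symm⟩
  rw [mem_graph_product_iff]
  refine ⟨p.snd, hp, (mem_graph_adjoint_iff hT _ _).2 fun x => ?_⟩
  have h₃ := (Submodule.mem_orthogonal _ _).1 hq (WithLp.toLp 2 (x, T x)) (T.mem_graph x)
  have h₄ : inner ℂ (x : H) q.fst + inner ℂ (T x) q.snd = 0 := h₃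
  rw [eq_neg_of_add_eq_zero_left h₂.symm, inner_neg_right]
  exact (eq_neg_of_add_eq_zero_left h₄).symm

/-- If `T` is closed and densely defined, then `T* T` is positive and selfadjoint. -/
theorem isPositiveSelfAdjoint_adjoint_product {T : H →ₗ.[ℂ] K} (hT : Dense (T.domain : Set H))
    (hc : T.IsClosed) : IsPositiveSelfAdjoint (product T.adjoint T) := by
  refine isPositiveSelfAdjoint_of_surjective ⟨fun x y => ?_, fun x => ?_⟩
    (exists_mem_graph_adjoint_product hT hc)
  · obtain ⟨hx, h⟩ := (mem_graph_adjoint_product_iff hT _ _).1 ((product T.adjoint T).mem_graph x)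
    obtain ⟨hy, h'⟩ := (mem_graph_adjoint_product_iff hT _ _).1 ((product T.adjoint T).mem_graph y)
    rw [← inner_conj_symm, ← h ⟨y, hy⟩, inner_conj_symm, h' ⟨x, hx⟩]
  · obtain ⟨hx, h⟩ := (mem_graph_adjoint_product_iff hT _ _).1 ((product T.adjoint T).mem_graph x)
    rw [← inner_conj_symm, ← h ⟨x, hx⟩, inner_conj_symm]
    exact inner_self_nonneg (𝕜 := ℂ)

/-- `dom (T* T)` is a core of `T`. -/
theorem mem_closure_graph_of_adjoint_product {T : H →ₗ.[ℂ] K} (hT : Dense (T.domain : Set H))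
    (hc : T.IsClosed) (x : T.domain) :
    ((x : H), T x) ∈
      closure {p : H × K | p ∈ T.graph ∧ p.1 ∈ (product T.adjoint T).domain} := by
  set e := (WithLp.linearEquiv 2 ℂ (H × K)).toLinearMap
  let M : Submodule ℂ (WithLp 2 (H × K)) :=
    hilbertGraph T ⊓ ((product T.adjoint T).domain.prod ⊤).comap e
  have hM : M.topologicalClosure ≤ hilbertGraph T :=
    M.topologicalClosure_minimal inf_le_left (isClosed_hilbertGraph hc)
  have : CompleteSpace M.topologicalClosure := M.isClosed_topologicalClosure.completeSpace_coe
  obtain ⟨m, hm, n, hn, hmn⟩ :=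
    M.topologicalClosure.exists_add_mem_mem_orthogonal (WithLp.toLp 2 ((x : H), T x))
  have hnG : n ∈ hilbertGraph T := by
    have : n = WithLp.toLp 2 ((x : H), T x) - m := by rw [hmn]; abel
    rw [this]
    exact Submodule.sub_mem _ (T.mem_graph x) (hM hm)
  have hn₁ : n.fst = 0 := by
    -- Here `n = (v, T v)` is orthogonal to the graph of `T` over `dom (T* T)`. Testing with `u`
    -- such that `u + T* T u = v` gives `0 = (u + T* T u, v) = ‖v‖²`.
    obtain ⟨u, z, huz, huz'⟩ := exists_mem_graph_adjoint_product hT hc n.fst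
    obtain ⟨hu, h⟩ := (mem_graph_adjoint_product_iff hT _ _).1 huz
    have h₁ := (Submodule.mem_orthogonal _ _).1 hn (WithLp.toLp 2 (u, T ⟨u, hu⟩))
      (M.le_topologicalClosure ⟨T.mem_graph ⟨u, hu⟩, mem_domain_of_mem_graph huz, trivial⟩)
    have h₂ : inner ℂ u n.fst + inner ℂ (T ⟨u, hu⟩) n.snd = 0 := h₁
    obtain ⟨v, hv, hv'⟩ := (mem_graph_iff T).1 (mem_hilbertGraph.1 hnG)
    dsimp only at hv hv'
    rw [← hv', ← inner_conj_symm (T _) (T _), h v, inner_conj_symm, hv, ← inner_add_left,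
      huz', inner_self_eq_zero] at h₂
    exact h₂
  have hn₂ : n.snd = 0 := graph_fst_eq_zero_snd T (mem_hilbertGraph.1 hnG) hn₁
  have hn₀ : n = 0 := by
    apply (WithLp.linearEquiv 2 ℂ (H × K)).injective
    exact Prod.ext hn₁ hn₂
  rw [hn₀, add_zero] at hmn
  rw [← hmn] at hm
  exact map_mem_closure (s := (M : Set (WithLp 2 (H × K))))
    (WithLp.prod_continuous_ofLp 2 H K) hm fun p hp => ⟨hp.1, hp.2.1⟩

/-- The closed operators `T`, `R` with `T* T = R* R` define the same form. -/
theorem exists_norm_eq_of_adjoint_product_eq {T : H →ₗ.[ℂ] K} {R : H →ₗ.[ℂ] L}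
    (hT : Dense (T.domain : Set H)) (hTc : T.IsClosed) (hR : Dense (R.domain : Set H))
    (hRc : R.IsClosed) (hTR : product T.adjoint T = product R.adjoint R) (x : T.domain) :
    ∃ hx : (x : H) ∈ R.domain, ‖R ⟨x, hx⟩‖ = ‖T x‖ := by
  obtain ⟨p, hp, hlim⟩ := mem_closure_iff_seq_limit.1
    (mem_closure_graph_of_adjoint_product hT hTc x)
  have hlim₁ : Tendsto (fun k => (p k).1) atTop (𝓝 (x : H)) := (continuous_fst.tendsto _).comp hlim
  have hlim₂ : Tendsto (fun k => (p k).2) atTop (𝓝 (T x)) := (continuous_snd.tendsto _).comp hlim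
  -- On the core the norms agree, because `‖T u‖² = (u, T* T u) = (u, R* R u) = ‖R u‖²`. Hence `T uₖ
  -- ↦ R uₖ` preserves distances, and closedness of `R` carries the identity to the limit.
  have key : ∀ u v, (u, v) ∈ T.graph → u ∈ (product T.adjoint T).domain →
      ∃ w, (u, w) ∈ R.graph ∧ ‖w‖ = ‖v‖ := by
    intro u v huv hu
    obtain ⟨z, h₁⟩ := mem_domain_iff.1 hu
    have h₂ := h₁
    rw [hTR] at h₂
    obtain ⟨hu₁, h₁⟩ := (mem_graph_adjoint_product_iff hT _ _).1 h₁
    obtain ⟨hu₂, h₂⟩ := (mem_graph_adjoint_product_iff hR _ _).1 h₂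
    refine ⟨R ⟨u, hu₂⟩, R.mem_graph ⟨u, hu₂⟩, ?_⟩
    rw [mem_graph_snd_inj T huv (T.mem_graph ⟨u, hu₁⟩) rfl]
    have h₃ := (h₂ ⟨u, hu₂⟩).trans (h₁ ⟨u, hu₁⟩).symm
    rw [inner_self_eq_norm_sq_to_K, inner_self_eq_norm_sq_to_K] at h₃
    exact (sq_eq_sq₀ (norm_nonneg _) (norm_nonneg _)).1 (by exact_mod_cast h₃)
  choose w hw hwn using fun k => key _ _ (hp k).1 (hp k).2
  have hdist : ∀ k l, dist (w k) (w l) = dist (p k).2 (p l).2 := by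
    intro k l
    obtain ⟨w', hw', hn⟩ := key _ _ (T.graph.sub_mem (hp k).1 (hp l).1)
      (Submodule.sub_mem _ (hp k).2 (hp l).2)
    rw [dist_eq_norm, dist_eq_norm, ← hn,
      mem_graph_snd_inj R hw' (R.graph.sub_mem (hw k) (hw l)) rfl]
  have hcau : CauchySeq w := by
    have := hlim₂.cauchySeq
    rw [Metric.cauchySeq_iff] at this ⊢
    simpa only [hdist] using this
  obtain ⟨w₀, hw₀⟩ := cauchySeq_tendsto_of_complete hcau
  have hmem : ((x : H), w₀) ∈ R.graph :=
    hRc.mem_of_tendsto (hlim₁.prodMk_nhds hw₀) (Eventually.of_forall hw)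
  refine ⟨mem_domain_of_mem_graph hmem, ?_⟩
  rw [mem_graph_snd_inj R (R.mem_graph ⟨x, mem_domain_of_mem_graph hmem⟩) hmem rfl]
  refine tendsto_nhds_unique hw₀.norm ?_
  simpa only [hwn] using hlim₂.norm

end AdjointProduct

/-! ### Resolvents and square roots of positive selfadjoint operators. -/

section SquareRoot

variable {H : Type*} [NormedAddCommGroup H] [InnerProductSpace ℂ H] [CompleteSpace H]

/-- `1 + A` is surjective if `A` is positive and selfadjoint. -/
theorem IsPositiveSelfAdjoint.exists_mem_graph_add_eq {A : H →ₗ.[ℂ] H}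
    (hA : IsPositiveSelfAdjoint A) (h : H) : ∃ x z, (x, z) ∈ A.graph ∧ x + z = h := by
  have : CompleteSpace (hilbertGraph A) :=
    (isClosed_hilbertGraph hA.selfAdjoint.isClosed).completeSpace_coe
  let f : hilbertGraph A →L[ℂ] H :=
    (WithLp.fstL 2 ℂ H H + WithLp.sndL 2 ℂ H H) ∘L (hilbertGraph A).subtypeL
  have hf : ∀ p : hilbertGraph A, f p = (p : WithLp 2 (H × H)).fst + (p : WithLp 2 (H × H)).snd :=
    fun p => rfl
  have hanti : AntilipschitzWith 1 f := by
    refine AddMonoidHomClass.antilipschitz_of_bound f fun p => ?_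
    have h₁ := norm_sq_add_norm_sq_le
      (re_inner_nonneg_of_mem_graph hA.nonneg (mem_hilbertGraph.1 p.2))
    rw [← WithLp.prod_norm_sq_eq_of_L2, ← hf] at h₁
    rw [NNReal.coe_one, one_mul]
    exact (sq_le_sq₀ (norm_nonneg _) (norm_nonneg _)).1 h₁
  have hclosed : IsClosed ((LinearMap.range f.toLinearMap : Submodule ℂ H) : Set H) :=
    hanti.isClosed_range f.uniformContinuous
  have hdense : Dense ((LinearMap.range f.toLinearMap : Submodule ℂ H) : Set H) := by
    refine dense_of_forall_inner_eq_zero fun y hy => ?_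
    -- A vector orthogonal to the range of `1 + A` satisfies `A* y = -y`, and `A* = A`; positivity
    -- then forces `y = 0`.
    have hmem : (y, -y) ∈ A.graph := by
      rw [← isSelfAdjoint_def.1 hA.selfAdjoint,
        mem_graph_adjoint_iff hA.selfAdjoint.dense_domain]
      intro x
      have h₁ := hy _ ⟨⟨WithLp.toLp 2 ((x : H), A x), A.mem_graph x⟩, rfl⟩
      have h₂ : inner ℂ ((x : H) + A x) y = 0 := h₁
      rw [inner_add_left] at h₂
      rw [inner_neg_right]
      exact eq_neg_of_add_eq_zero_right h₂
    have h₁ := norm_sq_add_norm_sq_le (re_inner_nonneg_of_mem_graph hA.nonneg hmem)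
    rw [add_neg_cancel, norm_zero, norm_neg] at h₁
    exact norm_eq_zero.1 (by nlinarith [norm_nonneg y])
  have hmem : h ∈ (LinearMap.range f.toLinearMap : Set H) := by
    rw [← hclosed.closure_eq, hdense.closure_eq]
    trivial
  obtain ⟨p, hp⟩ := hmem
  exact ⟨_, _, mem_hilbertGraph.1 p.2, hp⟩

/-- The resolvent `B = (1 + A)⁻¹` of a positive selfadjoint operator. -/
theorem IsPositiveSelfAdjoint.exists_resolvent {A : H →ₗ.[ℂ] H} (hA : IsPositiveSelfAdjoint A) :
    ∃ B : H →L[ℂ] H, 0 ≤ B ∧ 0 ≤ 1 - B ∧ ∀ x z, (x, z) ∈ A.graph ↔ B (x + z) = x := by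
  have hsymm : ∀ {x z y w : H}, (x, z) ∈ A.graph → (y, w) ∈ A.graph →
      inner ℂ z y = inner ℂ x w := by
    intro x z y w hxz hyw
    obtain ⟨x, rfl, rfl⟩ := (mem_graph_iff A).1 hxz
    obtain ⟨y, rfl, rfl⟩ := (mem_graph_iff A).1 hyw
    exact hA.symm x y
  have hunique : ∀ {x z y w : H}, (x, z) ∈ A.graph → (y, w) ∈ A.graph → x + z = y + w →
      x = y := by
    intro x z y w hxz hyw h
    have h₁ := norm_sq_add_norm_sq_le
      (re_inner_nonneg_of_mem_graph hA.nonneg (A.graph.sub_mem hxz hyw))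
    rw [sub_add_sub_comm, h, sub_self, norm_zero] at h₁
    exact sub_eq_zero.1 (norm_eq_zero.1
      (by nlinarith [norm_nonneg (x - y), sq_nonneg ‖z - w‖]))
  choose r s hrs hsum using hA.exists_mem_graph_add_eq
  have hs : ∀ h, s h = h - r h := fun h => eq_sub_of_add_eq' (hsum h)
  let B₀ : H →ₗ[ℂ] H :=
    { toFun := r
      map_add' := fun h k => hunique (hrs _) (A.graph.add_mem (hrs h) (hrs k)) (by
        rw [hsum, add_add_add_comm, hsum, hsum])
      map_smul' := fun c h => hunique (hrs _) (A.graph.smul_mem c (hrs h)) (by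
        simp only [RingHom.id_apply]
        rw [hsum, ← smul_add, hsum]) }
  have hnonneg : ∀ h, 0 ≤ (inner ℂ (s h) (r h)).re := fun h =>
    re_inner_nonneg_of_mem_graph hA.nonneg (hrs h)
  let B : H →L[ℂ] H := B₀.mkContinuous 1 fun h => by
    have h₁ := norm_sq_add_norm_sq_le (hnonneg h)
    rw [hsum] at h₁
    rw [one_mul]
    exact (sq_le_sq₀ (norm_nonneg _) (norm_nonneg _)).1
      ((le_add_of_nonneg_right (sq_nonneg _)).trans h₁)
  have hB : ∀ h, B h = r h := fun h => rfl
  have hself : ∀ h k, inner ℂ (r h) k = inner ℂ h (r k) := by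
    intro h k
    calc inner ℂ (r h) k = inner ℂ (r h) (r k) + inner ℂ (r h) (s k) := by
          rw [← inner_add_right, hsum]
      _ = inner ℂ (r h) (r k) + inner ℂ (s h) (r k) := by rw [hsymm (hrs h) (hrs k)]
      _ = inner ℂ h (r k) := by rw [← inner_add_left, hsum]
  refine ⟨B, ?_, ?_, fun x z => ⟨fun hxz => ?_, fun hxz => ?_⟩⟩
  · rw [ContinuousLinearMap.nonneg_iff_isPositive, ContinuousLinearMap.isPositive_def]
    refine ⟨fun h k => hself h k, fun h => ?_⟩
    rw [ContinuousLinearMap.reApplyInnerSelf_apply, hB]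
    nth_rewrite 2 [← hsum h]
    rw [inner_add_right, ← inner_conj_symm (r h) (s h), map_add, RCLike.conj_re]
    exact add_nonneg inner_self_nonneg (hnonneg h)
  · rw [ContinuousLinearMap.nonneg_iff_isPositive, ContinuousLinearMap.isPositive_def]
    refine ⟨fun h k => ?_, fun h => ?_⟩
    · change inner ℂ (h - r h) k = inner ℂ h (k - r k)
      rw [inner_sub_left, inner_sub_right, hself]
    · rw [ContinuousLinearMap.reApplyInnerSelf_apply]
      change 0 ≤ RCLike.re (inner ℂ (h - r h) h)
      rw [← hs]
      nth_rewrite 2 [← hsum h]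
      rw [inner_add_right, map_add]
      exact add_nonneg (hnonneg h) inner_self_nonneg
  · exact hunique (hrs _) hxz (hsum _)
  · have h₁ := hrs (x + z)
    rw [hs, ← hB, hxz, add_sub_cancel_left] at h₁
    exact h₁

/-- If `C` and `S` are commuting bounded positive operators with `C² + S² = 1` and `C` is
injective, then `C x ↦ S x` is positive and selfadjoint, and its square is `C² x ↦ S² x`. -/
theorem exists_isSqrt_of_commute {A : H →ₗ.[ℂ] H} {C S : H →L[ℂ] H} (hC : 0 ≤ C) (hS : 0 ≤ S)
    (hCS : Commute C S) (hone : C * C + S * S = 1) (hinj : ∀ x, C x = 0 → x = 0)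
    (hA : ∀ x z, (x, z) ∈ A.graph ↔ ∃ w, C (C w) = x ∧ S (S w) = z) : ∃ R, IsSqrt R A := by
  have hcomm : ∀ x, C (S x) = S (C x) := fun x => congrArg (fun T : H →L[ℂ] H => T x) hCS.eq
  have hone' : ∀ x, C (C x) + S (S x) = x := fun x =>
    congrArg (fun T : H →L[ℂ] H => T x) hone
  have hCsymm : ∀ x y, inner ℂ (C x) y = inner ℂ x (C y) :=
    ((ContinuousLinearMap.nonneg_iff_isPositive C).1 hC).isSymmetric
  have hSsymm : ∀ x y, inner ℂ (S x) y = inner ℂ x (S y) :=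
    ((ContinuousLinearMap.nonneg_iff_isPositive S).1 hS).isSymmetric
  let g : Submodule ℂ (H × H) := LinearMap.range (C.toLinearMap.prod S.toLinearMap)
  have hg : ∀ x z, (x, z) ∈ g ↔ ∃ w, C w = x ∧ S w = z := fun x z => by
    simp [g, LinearMap.mem_range]
  have hgraph : g.toLinearPMap.graph = g := by
    refine g.toLinearPMap_graph_eq fun p hp hp₁ => ?_
    obtain ⟨w, hw₁, hw₂⟩ := (hg p.1 p.2).1 hp
    rw [← hw₂, hinj w (hw₁.trans hp₁), map_zero]
  have hmem : ∀ x z, (x, z) ∈ g.toLinearPMap.graph ↔ ∃ w, C w = x ∧ S w = z := by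
    rw [hgraph]
    exact hg
  have hd : Dense (g.toLinearPMap.domain : Set H) := by
    refine dense_of_forall_inner_eq_zero fun y hy => hinj y ?_
    rw [← inner_self_eq_zero (𝕜 := ℂ), ← hCsymm]
    exact hy _ (mem_domain_of_mem_graph ((hmem _ _).2 ⟨C y, rfl, rfl⟩))
  have hsolve : ∀ y z, S y = C z → ∃ w, C w = y ∧ S w = z := by
    intro y z h
    -- The only candidate: `C w = y` and `S w = z` imply `w = C² w + S² w = C y + S z`.
    refine ⟨C y + S z, ?_, ?_⟩
    · rw [map_add, hcomm, ← h, hone']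
    · rw [map_add, ← hcomm, h, hone']
  refine ⟨g.toLinearPMap, ⟨isSelfAdjoint_def.2 (eq_of_eq_graph ?_), fun x => ?_⟩,
    eq_of_eq_graph ?_⟩
  · ext ⟨y, z⟩
    rw [mem_graph_adjoint_iff hd, hmem]
    constructor
    · intro h
      refine hsolve y z (ext_inner_left ℂ fun w => ?_)
      obtain ⟨x, hx₁, hx₂⟩ := (mem_graph_iff _).1 ((hmem (C w) (S w)).2 ⟨w, rfl, rfl⟩)
      have h₁ := h x
      rw [hx₁, hx₂] at h₁
      rw [← hSsymm, ← hCsymm]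
      exact h₁
    · rintro ⟨w, rfl, rfl⟩ x
      obtain ⟨u, hu₁, hu₂⟩ := (hmem _ _).1 (g.toLinearPMap.mem_graph x)
      rw [← hu₁, ← hu₂, hSsymm, hCsymm, hcomm]
  · obtain ⟨u, hu₁, hu₂⟩ := (hmem _ _).1 (g.toLinearPMap.mem_graph x)
    rw [← hu₁, ← hu₂, ← hCsymm]
    exact ((ContinuousLinearMap.nonneg_iff_isPositive (C * S)).1
      (hCS.mul_nonneg hC hS)).re_inner_nonneg_left u
  · ext ⟨x, z⟩
    rw [mem_graph_product_iff, hA]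
    constructor
    · rintro ⟨y, hxy, hyz⟩
      obtain ⟨u, rfl, rfl⟩ := (hmem _ _).1 hxy
      obtain ⟨v, hv, rfl⟩ := (hmem _ _).1 hyz
      obtain ⟨w, rfl, rfl⟩ := hsolve u v hv.symm
      exact ⟨w, rfl, rfl⟩
    · rintro ⟨w, rfl, rfl⟩
      exact ⟨S (C w), (hmem _ _).2 ⟨_, rfl, rfl⟩, (hmem _ _).2 ⟨S w, hcomm w, rfl⟩⟩

/-- With `B = (1 + A)⁻¹` the graph of `A` is `{(B w, (1 - B) w)}`. So `√B w ↦ √(1 - B) w` is a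
square root, and only the functional calculus of bounded operators is used. -/
theorem IsPositiveSelfAdjoint.exists_isSqrt {A : H →ₗ.[ℂ] H} (hA : IsPositiveSelfAdjoint A) :
    ∃ R, IsSqrt R A := by
  obtain ⟨B, hB, hB', hBA⟩ := hA.exists_resolvent
  have hC := CFC.sqrt_mul_sqrt_self B hB
  have hS := CFC.sqrt_mul_sqrt_self (1 - B) hB'
  have hcomm : Commute (CFC.sqrt B) (CFC.sqrt (1 - B)) := by
    have h₁ : Commute B (1 - B) := (Commute.one_right B).sub_right (Commute.refl B)
    exact (((h₁.cfcₙ_nnreal NNReal.sqrt).symm).cfcₙ_nnreal NNReal.sqrt).symm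
  have hC' : ∀ x, CFC.sqrt B (CFC.sqrt B x) = B x := fun x =>
    congrArg (fun T : H →L[ℂ] H => T x) hC
  have hS' : ∀ x, CFC.sqrt (1 - B) (CFC.sqrt (1 - B) x) = x - B x := fun x =>
    congrArg (fun T : H →L[ℂ] H => T x) hS
  refine exists_isSqrt_of_commute (CFC.sqrt_nonneg B) (CFC.sqrt_nonneg (1 - B)) hcomm
    (by rw [hC, hS, add_sub_cancel]) (fun x hx => ?_) fun x z => ?_
  -- `B x = 0` means that `(0, x)` lies in the graph of `A`.
  · have h₁ : B x = 0 := by rw [← hC', hx, map_zero]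
    exact graph_fst_eq_zero_snd A ((hBA 0 x).2 (by rw [zero_add, h₁])) rfl
  · rw [hBA]
    simp only [hC', hS']
    constructor
    · intro h
      exact ⟨x + z, h, by rw [h, add_sub_cancel_left]⟩
    · rintro ⟨w, rfl, rfl⟩
      rw [add_sub_cancel]

theorem IsPositiveSelfAdjoint.isSqrt_sqrt {A : H →ₗ.[ℂ] H} (hA : IsPositiveSelfAdjoint A) :
    IsSqrt (sqrt A) A := by
  rw [sqrt, dif_pos hA.exists_isSqrt]
  exact hA.exists_isSqrt.choose_spec

end SquareRoot

/-! ### Operators that define the same quadratic form. -/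

section SameForm

variable {H K L : Type*} [NormedAddCommGroup H] [InnerProductSpace ℂ H]
  [NormedAddCommGroup K] [InnerProductSpace ℂ K] [NormedAddCommGroup L] [InnerProductSpace ℂ L]

/-- The forms `(T x, T y)` and `(R x, R y)` have the same domain and agree. -/
structure SameForm (T : H →ₗ.[ℂ] K) (R : H →ₗ.[ℂ] L) : Prop where
  domain_eq : T.domain = R.domain
  norm_eq : ∀ (x : H) (hT : x ∈ T.domain) (hR : x ∈ R.domain), ‖T ⟨x, hT⟩‖ = ‖R ⟨x, hR⟩‖

/-- Polarization. -/
theorem SameForm.inner_eq {T : H →ₗ.[ℂ] K} {R : H →ₗ.[ℂ] L} (h : SameForm T R) {x y : H}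
    (hx : x ∈ T.domain) (hy : y ∈ T.domain) (hx' : x ∈ R.domain) (hy' : y ∈ R.domain) :
    inner ℂ (T ⟨x, hx⟩) (T ⟨y, hy⟩) = inner ℂ (R ⟨x, hx'⟩) (R ⟨y, hy'⟩) := by
  have hadd : ∀ c : ℂ, ‖T ⟨x, hx⟩ + c • T ⟨y, hy⟩‖ = ‖R ⟨x, hx'⟩ + c • R ⟨y, hy'⟩‖ := by
    intro c
    rw [← LinearPMap.map_smul, ← LinearPMap.map_add, ← LinearPMap.map_smul, ← LinearPMap.map_add]
    exact h.norm_eq _ _ _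
  have h₁ := hadd 1
  have h₂ := hadd (-1)
  have h₃ := hadd Complex.I
  have h₄ := hadd (-Complex.I)
  simp only [one_smul, neg_smul, ← sub_eq_add_neg] at h₁ h₂ h₃ h₄
  rw [inner_eq_sum_norm_sq_div_four, inner_eq_sum_norm_sq_div_four]
  simp only [RCLike.I_to_complex, h₁, h₂, h₃, h₄]

variable [CompleteSpace H]

theorem SameForm.adjoint_product_eq {T : H →ₗ.[ℂ] K} {R : H →ₗ.[ℂ] L} (h : SameForm T R)
    (hT : Dense (T.domain : Set H)) : product T.adjoint T = product R.adjoint R := by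
  have hR : Dense (R.domain : Set H) := h.domain_eq ▸ hT
  have hmem : ∀ {x : H}, x ∈ T.domain ↔ x ∈ R.domain := fun {x} => by rw [h.domain_eq]
  refine eq_of_eq_graph ?_
  ext ⟨x, z⟩
  rw [mem_graph_adjoint_product_iff hT, mem_graph_adjoint_product_iff hR]
  constructor
  · rintro ⟨hx, hz⟩
    refine ⟨hmem.1 hx, fun y => ?_⟩
    rw [← h.inner_eq (hmem.2 y.2) hx y.2 (hmem.1 hx)]
    exact hz ⟨y, hmem.2 y.2⟩
  · rintro ⟨hx, hz⟩
    refine ⟨hmem.2 hx, fun y => ?_⟩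
    rw [h.inner_eq y.2 (hmem.2 hx) (hmem.1 y.2) hx]
    exact hz ⟨y, hmem.1 y.2⟩

theorem sameForm_of_adjoint_product_eq [CompleteSpace K] [CompleteSpace L] {T : H →ₗ.[ℂ] K}
    {R : H →ₗ.[ℂ] L} (hT : Dense (T.domain : Set H)) (hTc : T.IsClosed)
    (hR : Dense (R.domain : Set H)) (hRc : R.IsClosed)
    (hTR : product T.adjoint T = product R.adjoint R) : SameForm T R := by
  refine ⟨le_antisymm (fun x hx => ?_) (fun x hx => ?_), fun x hx hx' => ?_⟩
  · exact (exists_norm_eq_of_adjoint_product_eq hT hTc hR hRc hTR ⟨x, hx⟩).choose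
  · exact (exists_norm_eq_of_adjoint_product_eq hR hRc hT hTc hTR.symm ⟨x, hx⟩).choose
  · exact (exists_norm_eq_of_adjoint_product_eq hT hTc hR hRc hTR ⟨x, hx⟩).choose_spec.symm

theorem IsSqrt.adjoint_product_eq {R A : H →ₗ.[ℂ] H} (h : IsSqrt R A) :
    product R.adjoint R = A := by
  rw [isSelfAdjoint_def.1 h.1.selfAdjoint, h.2]

/-- The form of `(T* T)^(1/2)` is the form of `T`. -/
theorem sameForm_sqrt_adjoint_product [CompleteSpace K] {T : H →ₗ.[ℂ] K}
    (hT : Dense (T.domain : Set H)) (hTc : T.IsClosed) :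
    SameForm (sqrt (product T.adjoint T)) T := by
  have h := (isPositiveSelfAdjoint_adjoint_product hT hTc).isSqrt_sqrt
  exact sameForm_of_adjoint_product_eq h.1.selfAdjoint.dense_domain h.1.selfAdjoint.isClosed
    hT hTc h.adjoint_product_eq

/-- The two inequalities make the forms of `A` and `B` coincide, and each operator is recovered from
its form as `R* R`, where `R` is its square root. -/
theorem FormLE.antisymm {A B : H →ₗ.[ℂ] H} (hA : IsPositiveSelfAdjoint A)
    (hB : IsPositiveSelfAdjoint B) (hAB : FormLE A B) (hBA : FormLE B A) : A = B := by
  have h : SameForm (sqrt A) (sqrt B) :=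
    ⟨le_antisymm (fun x hx => (hBA x hx).choose) (fun x hx => (hAB x hx).choose),
      fun x hx hx' => le_antisymm (hAB x hx').choose_spec (hBA x hx).choose_spec⟩
  rw [← hA.isSqrt_sqrt.adjoint_product_eq, ← hB.isSqrt_sqrt.adjoint_product_eq]
  exact h.adjoint_product_eq hA.isSqrt_sqrt.1.selfAdjoint.dense_domain

end SameForm

/-! ### The Krein–von Neumann extension and the form sum. -/

section Krein

variable {H : Type*} [NormedAddCommGroup H] [InnerProductSpace ℂ H] {a b : H →ₗ.[ℂ] H}
  (ha : IsPositiveSymmetric a) (hd : Dense (formDomain a))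

theorem RanSpace.mk_preimage (u : RanSpace ha hd) :
    RanSpace.mk ha hd (RanSpace.preimage ha hd u) = u :=
  Subtype.ext (RanSpace.apply_preimage ha hd u)

theorem RanSpace.norm_mk_sq (x : a.domain) :
    ‖RanSpace.mk ha hd x‖ ^ 2 = (inner ℂ (a x) (x : H)).re := by
  rw [← RanSpace.inner_eq ha hd x x, inner_self_eq_norm_sq_to_K]
  norm_cast

/-- The operator `ax ↦ ax` from the energy space `H_a` to `H`, with domain `ran a`. -/
noncomputable def ranOperator : EnergySpace ha hd →ₗ.[ℂ] H where
  domain := LinearMap.range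
    (UniformSpace.Completion.toComplₗᵢ (𝕜 := ℂ) (E := RanSpace ha hd)).toLinearMap
  toFun := RanSpace.incl ha hd ∘ₗ (LinearEquiv.ofInjective _
    (UniformSpace.Completion.toComplₗᵢ (𝕜 := ℂ) (E := RanSpace ha hd)).injective).symm.toLinearMap

theorem coe_mem_ranOperator_domain (u : RanSpace ha hd) :
    (u : EnergySpace ha hd) ∈ (ranOperator ha hd).domain := ⟨u, rfl⟩

theorem ranOperator_coe (u : RanSpace ha hd) :
    ranOperator ha hd ⟨(u : EnergySpace ha hd), coe_mem_ranOperator_domain ha hd u⟩ =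
      RanSpace.incl ha hd u := by
  change RanSpace.incl ha hd ((LinearEquiv.ofInjective _
    (UniformSpace.Completion.toComplₗᵢ (𝕜 := ℂ) (E := RanSpace ha hd)).injective).symm
      (LinearEquiv.ofInjective _
        (UniformSpace.Completion.toComplₗᵢ (𝕜 := ℂ) (E := RanSpace ha hd)).injective u)) = _
  rw [LinearEquiv.symm_apply_apply]

theorem dense_ranOperator_domain :
    Dense ((ranOperator ha hd).domain : Set (EnergySpace ha hd)) :=
  UniformSpace.Completion.denseRange_coe

theorem mem_graph_ranOperator_adjoint_iff (x : H) (w : EnergySpace ha hd) :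
    (x, w) ∈ (ranOperator ha hd).adjoint.graph ↔
      ∀ u : RanSpace ha hd, inner ℂ (RanSpace.incl ha hd u) x =
        inner ℂ (u : EnergySpace ha hd) w := by
  rw [mem_graph_adjoint_iff (dense_ranOperator_domain ha hd)]
  constructor
  · intro h u
    rw [← ranOperator_coe]
    exact h _
  · rintro h ⟨_, u, rfl⟩
    exact (congrArg (fun v => inner ℂ v x) (ranOperator_coe ha hd u)).trans (h u)

/-- Since `(az, z)` is the squared energy norm of `az`, the inequality defining the form domain says
precisely that `az ↦ (az, x)` is bounded on `ran a ⊆ H_a`. -/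
theorem mem_ranOperator_adjoint_domain_iff (x : H) :
    x ∈ (ranOperator ha hd).adjoint.domain ↔ x ∈ formDomain a := by
  constructor
  · intro hx
    obtain ⟨w, hw⟩ := mem_domain_iff.1 hx
    rw [mem_graph_ranOperator_adjoint_iff] at hw
    refine ⟨‖w‖ ^ 2, fun z => ?_⟩
    have h₁ : inner ℂ (a z) x = inner ℂ (RanSpace.mk ha hd z : EnergySpace ha hd) w :=
      hw (RanSpace.mk ha hd z)
    have h₂ := norm_inner_le_norm (𝕜 := ℂ) (RanSpace.mk ha hd z : EnergySpace ha hd) w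
    rw [UniformSpace.Completion.norm_coe] at h₂
    rw [h₁, ← RanSpace.norm_mk_sq ha hd, ← mul_pow, mul_comm]
    gcongr
  · rintro ⟨m, hm⟩
    rw [mem_adjoint_domain_iff]
    -- `formDomain` puts no sign condition on `m`, hence the absolute value.
    refine AddMonoidHomClass.continuous_of_bound _ (Real.sqrt |m|) ?_
    rintro ⟨_, u, rfl⟩
    change ‖inner ℂ x (ranOperator ha hd ⟨(u : EnergySpace ha hd),
      coe_mem_ranOperator_domain ha hd u⟩)‖ ≤ Real.sqrt |m| * ‖(u : EnergySpace ha hd)‖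
    rw [ranOperator_coe, norm_inner_symm, UniformSpace.Completion.norm_coe,
      ← RanSpace.mk_preimage ha hd u]
    have h₁ := hm (RanSpace.preimage ha hd u)
    rw [← RanSpace.norm_mk_sq ha hd] at h₁
    refine (sq_le_sq₀ (norm_nonneg _) (by positivity)).1 ?_
    rw [mul_pow, Real.sq_sqrt (abs_nonneg m)]
    exact h₁.trans (by gcongr; exact le_abs_self m)

theorem dense_ranOperator_adjoint_domain :
    Dense ((ranOperator ha hd).adjoint.domain : Set H) :=
  hd.mono fun x hx => (mem_ranOperator_adjoint_domain_iff ha hd x).2 hx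

theorem isClosed_ranOperator_adjoint : (ranOperator ha hd).adjoint.IsClosed :=
  adjoint_isClosed (dense_ranOperator_domain ha hd)

/-- By density the bound extends to the whole completion, where `w` can be tested against itself. -/
theorem norm_le_of_forall_norm_inner_coe_le {E : Type*} [NormedAddCommGroup E]
    [InnerProductSpace ℂ E] {w : UniformSpace.Completion E} {c : ℝ} (hc : 0 ≤ c)
    (h : ∀ u : E, ‖inner ℂ (u : UniformSpace.Completion E) w‖ ≤ c * ‖u‖) : ‖w‖ ≤ c := by
  have h₁ : ∀ v : UniformSpace.Completion E, ‖inner ℂ v w‖ ≤ c * ‖v‖ := by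
    intro v
    induction v using UniformSpace.Completion.induction_on with
    | hp => exact isClosed_le (by fun_prop) (by fun_prop)
    | ih u => simpa using h u
  rcases (norm_nonneg w).eq_or_lt with h₀ | h₀
  · rwa [← h₀]
  · have h₂ := h₁ w
    rw [inner_self_eq_norm_sq_to_K, norm_pow, RCLike.norm_ofReal, abs_norm, sq] at h₂
    exact le_of_mul_le_mul_right h₂ h₀

variable (hb : IsPositiveSymmetric b) (hab : Dense (formDomain a ∩ formDomain b))

theorem RanSpace.coe_zero : ((0 : RanSpace ha hd) : EnergySpace ha hd) = 0 :=
  (UniformSpace.Completion.toComplₗᵢ (𝕜 := ℂ) (E := RanSpace ha hd)).map_zero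

theorem coe_mem_sumOperator_domain (u : RanSpace ha (hab.mono Set.inter_subset_left))
    (v : RanSpace hb (hab.mono Set.inter_subset_right)) :
    WithLp.toLp 2 ((u : EnergySpace ha (hab.mono Set.inter_subset_left)),
      (v : EnergySpace hb (hab.mono Set.inter_subset_right))) ∈
        (sumOperator ha hb hab).domain := ⟨(u, v), rfl⟩

theorem sumOperator_coe (u : RanSpace ha (hab.mono Set.inter_subset_left))
    (v : RanSpace hb (hab.mono Set.inter_subset_right)) :
    sumOperator ha hb hab ⟨_, coe_mem_sumOperator_domain ha hb hab u v⟩ =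
      RanSpace.incl ha _ u + RanSpace.incl hb _ v := by
  have h := sumOperator_apply ha hb hab (RanSpace.preimage ha _ u) (RanSpace.preimage hb _ v)
  simp only [RanSpace.mk_preimage, RanSpace.apply_preimage] at h
  exact h

theorem dense_sumOperator_domain : Dense ((sumOperator ha hb hab).domain : Set
    (WithLp 2 (EnergySpace ha (hab.mono Set.inter_subset_left) ×
      EnergySpace hb (hab.mono Set.inter_subset_right)))) := by
  refine dense_of_forall_inner_eq_zero fun w hw => ?_
  have hw' : ∀ (u : RanSpace ha (hab.mono Set.inter_subset_left))
      (v : RanSpace hb (hab.mono Set.inter_subset_right)),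
      inner ℂ (u : EnergySpace ha (hab.mono Set.inter_subset_left)) w.fst +
      inner ℂ (v : EnergySpace hb (hab.mono Set.inter_subset_right)) w.snd = 0 := fun u v =>
    hw _ (coe_mem_sumOperator_domain ha hb hab u v)
  have h₁ : w.fst = 0 := by
    refine (dense_ranOperator_domain ha _).eq_zero_of_inner_right (𝕜 := ℂ) ?_
    rintro _ ⟨u, rfl⟩
    simpa [RanSpace.coe_zero] using hw' u 0
  have h₂ : w.snd = 0 := by
    refine (dense_ranOperator_domain hb _).eq_zero_of_inner_right (𝕜 := ℂ) ?_
    rintro _ ⟨v, rfl⟩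
    simpa [RanSpace.coe_zero] using hw' 0 v
  exact (WithLp.linearEquiv 2 ℂ _).injective (Prod.ext h₁ h₂)

/-- `J* x = J_a* x ⊕ J_b* x`. -/
theorem mem_graph_sumOperator_adjoint_iff (x : H)
    (w : WithLp 2 (EnergySpace ha (hab.mono Set.inter_subset_left) ×
      EnergySpace hb (hab.mono Set.inter_subset_right))) :
    (x, w) ∈ (sumOperator ha hb hab).adjoint.graph ↔
      (x, w.fst) ∈ (ranOperator ha (hab.mono Set.inter_subset_left)).adjoint.graph ∧
      (x, w.snd) ∈ (ranOperator hb (hab.mono Set.inter_subset_right)).adjoint.graph := by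
  rw [mem_graph_adjoint_iff (dense_sumOperator_domain ha hb hab),
    mem_graph_ranOperator_adjoint_iff, mem_graph_ranOperator_adjoint_iff]
  have key : (∀ y : (sumOperator ha hb hab).domain,
      inner ℂ (sumOperator ha hb hab y) x = inner ℂ (y : WithLp 2 _) w) ↔
      ∀ u v, inner ℂ (RanSpace.incl ha _ u + RanSpace.incl hb _ v) x =
        inner ℂ (u : EnergySpace ha (hab.mono Set.inter_subset_left)) w.fst +
        inner ℂ (v : EnergySpace hb (hab.mono Set.inter_subset_right)) w.snd := by
    constructor
    · intro h u v
      rw [← sumOperator_coe]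
      exact h _
    · rintro h ⟨_, ⟨u, v⟩, rfl⟩
      exact (congrArg (fun y => inner ℂ y x) (sumOperator_coe ha hb hab u v)).trans (h u v)
  rw [key]
  constructor
  · exact fun h => ⟨fun u => by simpa [RanSpace.coe_zero] using h u 0, fun v => by simpa [RanSpace.coe_zero] using h 0 v⟩
  · rintro ⟨h₁, h₂⟩ u v
    rw [inner_add_left, h₁, h₂]

variable [CompleteSpace H]

/-- The Krein-von Neumann extension of `a` is `J** J*`, where `J` is the embedding of `ran a`,
as a subspace of the energy space, in `H`. -/
theorem isKreinVonNeumannExtension_ranOperator :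
    IsKreinVonNeumannExtension a
      (product (ranOperator ha hd).adjoint.adjoint (ranOperator ha hd).adjoint) where
  positiveSelfAdjoint := isPositiveSelfAdjoint_adjoint_product
    (dense_ranOperator_adjoint_domain ha hd) (isClosed_ranOperator_adjoint ha hd)
  extends_op := by
    refine le_of_le_graph ?_
    rintro ⟨x, z⟩ hxz
    obtain ⟨x, rfl, rfl⟩ := (mem_graph_iff a).1 hxz
    rw [mem_graph_product_iff]
    -- Both `J_a* x = ax` and `J_a** (ax) = ax` hold for `x ∈ dom a`.
    refine ⟨(RanSpace.mk ha hd x : EnergySpace ha hd), ?_, ?_⟩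
    · rw [mem_graph_ranOperator_adjoint_iff]
      intro u
      rw [UniformSpace.Completion.inner_coe, ← RanSpace.mk_preimage ha hd u, RanSpace.inner_eq]
      rfl
    · rw [mem_graph_adjoint_iff (dense_ranOperator_adjoint_domain ha hd)]
      intro y
      have h₁ := (mem_graph_ranOperator_adjoint_iff ha hd _ _).1
        ((ranOperator ha hd).adjoint.mem_graph y) (RanSpace.mk ha hd x)
      rw [← inner_conj_symm, ← h₁, inner_conj_symm]
      rfl
  least S hS haS x hx := by
    have hR := hS.isSqrt_sqrt
    have hRd := hR.1.selfAdjoint.dense_domain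
    have hform := sameForm_sqrt_adjoint_product (dense_ranOperator_adjoint_domain ha hd)
      (isClosed_ranOperator_adjoint ha hd)
    -- Cauchy–Schwarz for the form of `S`: as `S z = az`, one has `(x, az) = (S^(1/2) x, S^(1/2)
    -- z)`, and `‖S^(1/2) z‖` is the energy norm of `az`.
    have hbound : ∀ z : a.domain,
        ‖inner ℂ (a z) x‖ ≤ ‖sqrt S ⟨x, hx⟩‖ * ‖RanSpace.mk ha hd z‖ := by
      intro z
      have hz : ((z : H), a z) ∈ (product (sqrt S).adjoint (sqrt S)).graph := by
        rw [hR.adjoint_product_eq]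
        exact le_graph_of_le haS (a.mem_graph z)
      obtain ⟨hz', h⟩ := (mem_graph_adjoint_product_iff hRd _ _).1 hz
      have h₁ : ‖RanSpace.mk ha hd z‖ = ‖sqrt S ⟨z, hz'⟩‖ := by
        refine (sq_eq_sq₀ (norm_nonneg _) (norm_nonneg _)).1 ?_
        rw [RanSpace.norm_mk_sq, ha.symm, ← h ⟨z, hz'⟩, inner_self_eq_norm_sq_to_K]
        norm_cast
      rw [norm_inner_symm, ← h ⟨x, hx⟩, h₁]
      exact norm_inner_le_norm _ _
    have hx' : x ∈ (ranOperator ha hd).adjoint.domain := by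
      rw [mem_ranOperator_adjoint_domain_iff]
      refine ⟨‖sqrt S ⟨x, hx⟩‖ ^ 2, fun z => ?_⟩
      rw [← RanSpace.norm_mk_sq ha hd, ← mul_pow]
      gcongr
      exact hbound z
    have hx'' := hx'
    rw [← hform.domain_eq] at hx''
    refine ⟨hx'', ?_⟩
    rw [hform.norm_eq x hx'' hx']
    refine norm_le_of_forall_norm_inner_coe_le (norm_nonneg _) fun u => ?_
    have h₁ := (mem_graph_ranOperator_adjoint_iff ha hd _ _).1
        ((ranOperator ha hd).adjoint.mem_graph ⟨x, hx'⟩) u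
    rw [← h₁, ← RanSpace.mk_preimage ha hd u]
    exact hbound _

theorem IsKreinVonNeumannExtension.unique {S T : H →ₗ.[ℂ] H}
    (hS : IsKreinVonNeumannExtension a S) (hT : IsKreinVonNeumannExtension a T) : S = T :=
  FormLE.antisymm hS.positiveSelfAdjoint hT.positiveSelfAdjoint
    (hS.least T hT.positiveSelfAdjoint hT.extends_op)
    (hT.least S hS.positiveSelfAdjoint hS.extends_op)

/-- If `T` and `R` define the forms of `A` and `B`, then the form sum of `A` and `B` is the operator
associated with the form `(T x, T y) + (R x, R y)`. -/
theorem mem_formSumGraph_iff {K L : Type*} [NormedAddCommGroup K] [InnerProductSpace ℂ K]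
    [NormedAddCommGroup L] [InnerProductSpace ℂ L] {A B : H →ₗ.[ℂ] H} {T : H →ₗ.[ℂ] K}
    {R : H →ₗ.[ℂ] L} (hA : SameForm (sqrt A) T) (hB : SameForm (sqrt B) R) (x z : H) :
    (x, z) ∈ formSumGraph A B ↔ ∃ (hT : x ∈ T.domain) (hR : x ∈ R.domain),
      ∀ (y : H) (kT : y ∈ T.domain) (kR : y ∈ R.domain),
        inner ℂ (T ⟨y, kT⟩) (T ⟨x, hT⟩) + inner ℂ (R ⟨y, kR⟩) (R ⟨x, hR⟩) = inner ℂ y z := by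
  have hAm : ∀ {x : H}, x ∈ (sqrt A).domain ↔ x ∈ T.domain := fun {x} => by rw [hA.domain_eq]
  have hBm : ∀ {x : H}, x ∈ (sqrt B).domain ↔ x ∈ R.domain := fun {x} => by rw [hB.domain_eq]
  constructor
  · rintro ⟨h₁, h₂, h⟩
    refine ⟨hAm.1 h₁, hBm.1 h₂, fun y k₁ k₂ => ?_⟩
    rw [← hA.inner_eq (hAm.2 k₁) h₁, ← hB.inner_eq (hBm.2 k₂) h₂]
    exact h y _ _
  · rintro ⟨h₁, h₂, h⟩
    refine ⟨hAm.2 h₁, hBm.2 h₂, fun y k₁ k₂ => ?_⟩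
    rw [hA.inner_eq k₁ (hAm.2 h₁) (hAm.1 k₁) h₁, hB.inner_eq k₂ (hBm.2 h₂) (hBm.1 k₂) h₂]
    exact h y _ _

/-- The inner product of `H_a ⊕ H_b` splits `(J* y, J* x)` into the forms of `J_a*` and `J_b*`, so
both sides are the operator of one form on one domain. -/
theorem formSum_eq_sumOperator :
    formSum
      (product (ranOperator ha (hab.mono Set.inter_subset_left)).adjoint.adjoint
        (ranOperator ha (hab.mono Set.inter_subset_left)).adjoint)
      (product (ranOperator hb (hab.mono Set.inter_subset_right)).adjoint.adjoint
        (ranOperator hb (hab.mono Set.inter_subset_right)).adjoint) =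
      product (sumOperator ha hb hab).adjoint.adjoint (sumOperator ha hb hab).adjoint := by
  have hA := sameForm_sqrt_adjoint_product
    (dense_ranOperator_adjoint_domain ha (hab.mono Set.inter_subset_left))
    (isClosed_ranOperator_adjoint ha (hab.mono Set.inter_subset_left))
  have hB := sameForm_sqrt_adjoint_product
    (dense_ranOperator_adjoint_domain hb (hab.mono Set.inter_subset_right))
    (isClosed_ranOperator_adjoint hb (hab.mono Set.inter_subset_right))
  set Ta := (ranOperator ha (hab.mono Set.inter_subset_left)).adjoint
  set Tb := (ranOperator hb (hab.mono Set.inter_subset_right)).adjoint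
  set J := (sumOperator ha hb hab).adjoint
  have hmem : ∀ {x : H}, x ∈ J.domain ↔ x ∈ Ta.domain ∧ x ∈ Tb.domain := by
    intro x
    constructor
    · intro hx
      obtain ⟨w, hw⟩ := mem_domain_iff.1 hx
      obtain ⟨h₁, h₂⟩ := (mem_graph_sumOperator_adjoint_iff ha hb hab x w).1 hw
      exact ⟨mem_domain_of_mem_graph h₁, mem_domain_of_mem_graph h₂⟩
    · rintro ⟨h₁, h₂⟩
      exact mem_domain_of_mem_graph ((mem_graph_sumOperator_adjoint_iff ha hb hab x
        (WithLp.toLp 2 (Ta ⟨x, h₁⟩, Tb ⟨x, h₂⟩))).2 ⟨Ta.mem_graph ⟨x, h₁⟩, Tb.mem_graph ⟨x, h₂⟩⟩)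
  have hinner : ∀ {x y : H} (hx : x ∈ J.domain) (hy : y ∈ J.domain)
      (hxa : x ∈ Ta.domain) (hya : y ∈ Ta.domain) (hxb : x ∈ Tb.domain) (hyb : y ∈ Tb.domain),
      inner ℂ (J ⟨y, hy⟩) (J ⟨x, hx⟩) = inner ℂ (Ta ⟨y, hya⟩) (Ta ⟨x, hxa⟩) +
        inner ℂ (Tb ⟨y, hyb⟩) (Tb ⟨x, hxb⟩) := by
    have happly : ∀ {x : H} (hx : x ∈ J.domain) (hxa : x ∈ Ta.domain) (hxb : x ∈ Tb.domain),
        J ⟨x, hx⟩ = WithLp.toLp 2 (Ta ⟨x, hxa⟩, Tb ⟨x, hxb⟩) := fun {x} hx hxa hxb =>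
      mem_graph_snd_inj J (J.mem_graph ⟨x, hx⟩) ((mem_graph_sumOperator_adjoint_iff ha hb hab x
        (WithLp.toLp 2 (Ta ⟨x, hxa⟩, Tb ⟨x, hxb⟩))).2
          ⟨Ta.mem_graph ⟨x, hxa⟩, Tb.mem_graph ⟨x, hxb⟩⟩) rfl
    intro x y hx hy hxa hya hxb hyb
    rw [happly hx hxa hxb, happly hy hya hyb]
    rfl
  -- `dom J*` is the intersection of the two form domains; its density makes both the form sum and
  -- `J**` meaningful.
  have hJd : Dense (J.domain : Set H) := by
    refine hab.mono fun x hx => hmem.2 ⟨?_, ?_⟩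
    · exact (mem_ranOperator_adjoint_domain_iff ha _ x).2 hx.1
    · exact (mem_ranOperator_adjoint_domain_iff hb _ x).2 hx.2
  refine eq_of_eq_graph ?_
  rw [formSum, Submodule.toLinearPMap_graph_eq _ (formSumGraph_singleValued _ _ ?_)]
  · ext ⟨x, z⟩
    rw [mem_formSumGraph_iff hA hB, mem_graph_adjoint_product_iff hJd]
    constructor
    · rintro ⟨h₁, h₂, h⟩
      refine ⟨hmem.2 ⟨h₁, h₂⟩, fun y => ?_⟩
      rw [hinner _ y.2 h₁ (hmem.1 y.2).1 h₂ (hmem.1 y.2).2]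
      exact h y _ _
    · rintro ⟨hx, h⟩
      refine ⟨(hmem.1 hx).1, (hmem.1 hx).2, fun y k₁ k₂ => ?_⟩
      rw [← hinner hx (hmem.2 ⟨k₁, k₂⟩)]
      exact h ⟨y, _⟩
  · rw [hA.domain_eq, hB.domain_eq]
    exact hJd.mono fun x hx => hmem.1 hx

end Krein

end FormSum

theorem theorem2 {H : Type*} [NormedAddCommGroup H] [InnerProductSpace ℂ H] [CompleteSpace H]
    (a b : H →ₗ.[ℂ] H) (ha : FormSum.IsPositiveSymmetric a) (hb : FormSum.IsPositiveSymmetric b)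
    (hab : Dense (FormSum.formDomain a ∩ FormSum.formDomain b)) :
    (∃! aK, FormSum.IsKreinVonNeumannExtension a aK) ∧
    (∃! bK, FormSum.IsKreinVonNeumannExtension b bK) ∧
    ∀ aK bK : H →ₗ.[ℂ] H,
      FormSum.IsKreinVonNeumannExtension a aK → FormSum.IsKreinVonNeumannExtension b bK →
      FormSum.formSum aK bK =
        FormSum.product (FormSum.sumOperator ha hb hab).adjoint.adjoint
          (FormSum.sumOperator ha hb hab).adjoint := by
  have hA := FormSum.isKreinVonNeumannExtension_ranOperator ha (hab.mono Set.inter_subset_left)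
  have hB := FormSum.isKreinVonNeumannExtension_ranOperator hb (hab.mono Set.inter_subset_right)
  refine ⟨⟨_, hA, fun S hS => hS.unique hA⟩, ⟨_, hB, fun S hS => hS.unique hB⟩,
    fun aK bK haK hbK => ?_⟩
  rw [haK.unique hA, hbK.unique hB]
  exact FormSum.formSum_eq_sumOperator ha hb hab
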